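/- For positive integers $l,k$ let $e(l,k)=\sum_{j=0}^{l-1}2^{jk}$, and for $t\ge 1$ let $K_t=2^{2t}-2^t+1$ be the Kasami exponent. The cyclotomic coset of $d$ modulo $2^n-1$ is $\{2^a d \bmod (2^n-1): a\ge 0\}$, and two exponents $x,d$ are cyclotomic equivalent over $\mathbb F_{2^n}$ if $x$, or the inverse $x^{-1}$ of $x$ modulo $2^n-1$ (when it exists), lies in the cyclotomic coset of $d$ modulo $2^n-1$. Let $n\neq 5$ be odd and let $1\le t\le n-1$ with $\gcd(n,t)=1$. Then $K_t$ is invertible modulo $2^n-1$, and its inverse $K_t^{-1}$ is cyclotomic equivalent over $\mathbb F_{2^n}$ to $e(l,i)$ for some positive integers $l,i$ with $n\nmid i$ if and only if $t=1$ or $t=n-1$. In both of these cases $K_t^{-1}$ lies in the cyclotomic coset of $e\left(\frac{n+1}{2},2\right)$ modulo $2^n-1$; hence $K_1^{-1}$ and $K_{n-1}^{-1}$ lie in the same cyclotomic coset modulo $2^n-1$. -/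

import Mathlib

/-- The exponent `e(l,k) = ∑_{j=0}^{l-1} 2^{jk}`. -/
def expE (l k : ℕ) : ℕ := ∑ j ∈ Finset.range l, 2 ^ (j * k)

/-- The Kasami exponent `K_t = 2^{2t} - 2^t + 1` (the subtraction never truncates,
since `2^t ≤ 2^{2t}`). -/
def kasami (t : ℕ) : ℕ := 2 ^ (2 * t) - 2 ^ t + 1

/-- `x` lies in the cyclotomic coset `{2^a d : a ∈ ℕ}` of `d` modulo `2^n - 1`. -/
def InCyclotomicCoset (n : ℕ) (x d : ZMod (2 ^ n - 1)) : Prop :=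
  ∃ a : ℕ, x = 2 ^ a * d

/-- `x` and `d` are cyclotomic equivalent modulo `2^n - 1`: either `x`, or the inverse `y` of `x`
(if `x` is invertible), lies in the cyclotomic coset of `d`. -/
def CyclotomicEquivalent (n : ℕ) (x d : ZMod (2 ^ n - 1)) : Prop :=
  InCyclotomicCoset n x d ∨ ∃ y : ZMod (2 ^ n - 1), x * y = 1 ∧ InCyclotomicCoset n y d

/-! Multiplying by `2 ^ i - 1` telescopes `e(l, i)`, so an equivalence with `K_t⁻¹` becomes an
equality of two sums of four powers of two modulo `2 ^ n - 1`, with exponents in `ZMod n`. By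
uniqueness of binary expansions, the exponents agree as multisets or both sides repeat one
(`eq_or_not_nodup_of_sum_twoPow_eq`); a repeat is carried and the shorter sums are compared. Every
branch gives linear relations in `ZMod n`, contradictory unless `t = ±1` or `k * t = 0` for some `1
≤ k ≤ 5` (`kasami_mul_ne`, `kasami_mul_sub_ne`). Conversely, `K_1 = 3` and `K_{n-1} = 3/4` are
inverted by the same telescoping. -/

/-- The power `2 ^ x` modulo `2 ^ n - 1`, with the exponent `x` taken modulo `n`. -/
def twoPow (n : ℕ) (x : ZMod n) : ZMod (2 ^ n - 1) := 2 ^ x.val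

lemma two_pow_eq_one (n : ℕ) : (2 : ZMod (2 ^ n - 1)) ^ n = 1 := by
  have h : ((2 ^ n - 1 : ℕ) : ZMod (2 ^ n - 1)) = 0 := ZMod.natCast_self _
  rw [Nat.cast_sub Nat.one_le_two_pow] at h
  push_cast at h
  exact sub_eq_zero.mp h

lemma twoPow_natCast (n k : ℕ) : twoPow n (k : ZMod n) = 2 ^ k := by
  rw [twoPow, ZMod.val_natCast]
  conv_rhs => rw [← Nat.mod_add_div k n, pow_add, pow_mul, two_pow_eq_one, one_pow, mul_one]

lemma twoPow_add {n : ℕ} [NeZero n] (x y : ZMod n) :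
    twoPow n (x + y) = twoPow n x * twoPow n y := by
  rw [← ZMod.natCast_zmod_val x, ← ZMod.natCast_zmod_val y, ← Nat.cast_add, twoPow_natCast,
    twoPow_natCast, twoPow_natCast, pow_add]

lemma twoPow_zero (n : ℕ) : twoPow n 0 = 1 := by
  simpa using twoPow_natCast n 0

lemma twoPow_add_one {n : ℕ} [NeZero n] (x : ZMod n) :
    twoPow n (x + 1) = twoPow n x + twoPow n x := by
  have h : twoPow n 1 = 2 := by simpa using twoPow_natCast n 1
  rw [twoPow_add, h, mul_two]

/-- Distinct proper subsets of the exponents have distinct sums of powers of two. -/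
lemma sum_twoPow_injective {n : ℕ} [NeZero n] {S T : Finset (ZMod n)}
    (hS : S.card < n) (hT : T.card < n)
    (h : ∑ x ∈ S, twoPow n x = ∑ x ∈ T, twoPow n x) : S = T := by
  have hinj : Function.Injective (ZMod.val : ZMod n → ℕ) := ZMod.val_injective n
  let v : ZMod n ↪ ℕ := ⟨ZMod.val, hinj⟩
  have hsub : ∀ U : Finset (ZMod n), U.map v ⊆ Finset.range n := by
    intro U y hy
    obtain ⟨x, -, rfl⟩ := Finset.mem_map.mp hy
    exact Finset.mem_range.mpr (ZMod.val_lt x)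
  -- The full set must be excluded: its sum `2 ^ n - 1` is congruent to the empty sum.
  have hlt : ∀ U : Finset (ZMod n), U.card < n →
      ∑ y ∈ U.map v, 2 ^ y < 2 ^ n - 1 := by
    intro U hU
    have h2 : ∑ y ∈ Finset.range n, 2 ^ y = 2 ^ n - 1 := by
      simpa using Nat.geomSum_eq (le_refl 2) n
    rw [← h2]
    have hss : U.map v ⊂ Finset.range n := by
      refine (hsub U).ssubset_of_ne fun he => ?_
      have := congrArg Finset.card he
      rw [Finset.card_map, Finset.card_range] at this
      omega
    obtain ⟨y, hy, hy'⟩ := Finset.exists_of_ssubset hss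
    exact Finset.sum_lt_sum_of_subset (hsub U) hy hy' (by positivity) (fun _ _ _ => Nat.zero_le _)
  have hcast : ∀ U : Finset (ZMod n),
      ∑ x ∈ U, twoPow n x = ((∑ y ∈ U.map v, 2 ^ y : ℕ) : ZMod (2 ^ n - 1)) := by
    intro U
    rw [Finset.sum_map]
    push_cast
    rfl
  rw [hcast, hcast, ZMod.natCast_eq_natCast_iff, Nat.ModEq, Nat.mod_eq_of_lt (hlt S hS),
    Nat.mod_eq_of_lt (hlt T hT)] at h
  exact Finset.map_injective v (Finset.geomSum_injective (le_refl 2) h)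

/-- Carrying turns a sum of powers of two into one with distinct exponents, and makes it shorter
if some exponents were repeated. -/
lemma exists_finset_sum_twoPow {n : ℕ} [NeZero n] (s : Multiset (ZMod n)) :
    ∃ T : Finset (ZMod n), T.card ≤ s.card ∧ (¬ s.Nodup → T.card < s.card) ∧
      ∑ x ∈ T, twoPow n x = (s.map (twoPow n)).sum := by
  induction hk : s.card using Nat.strong_induction_on generalizing s with
  | _ k ih =>
    by_cases hs : s.Nodup
    · exact ⟨⟨s, hs⟩, hk.le, fun h => absurd hs h, rfl⟩
    · have hx : ∃ x, ∃ r : Multiset (ZMod n), s = x ::ₘ x ::ₘ r := by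
        simpa [Multiset.nodup_iff_ne_cons_cons] using hs
      obtain ⟨x, r, rfl⟩ := hx
      simp only [Multiset.card_cons] at hk
      obtain ⟨T, hT, -, hsum⟩ := ih (k - 1) (by omega) ((x + 1) ::ₘ r)
        (by rw [Multiset.card_cons]; omega)
      refine ⟨T, by omega, fun _ => by omega, ?_⟩
      rw [hsum]
      simp [twoPow_add_one, add_assoc]

/-- If only one side had a repeat, carrying would write the other side's sum with fewer exponents,
against uniqueness. -/
lemma eq_or_not_nodup_of_sum_twoPow_eq {n : ℕ} [NeZero n] {s r : Multiset (ZMod n)}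
    (hc : s.card = r.card) (hn : s.card < n)
    (h : (s.map (twoPow n)).sum = (r.map (twoPow n)).sum) :
    s = r ∨ ¬ s.Nodup ∧ ¬ r.Nodup := by
  have key : ∀ s r : Multiset (ZMod n), s.card = r.card → s.card < n →
      (s.map (twoPow n)).sum = (r.map (twoPow n)).sum → s.Nodup → s = r := by
    intro s r hc hn h hs
    obtain ⟨T, hT, hT', hsum⟩ := exists_finset_sum_twoPow r
    have hST : (⟨s, hs⟩ : Finset (ZMod n)) = T :=
      sum_twoPow_injective (by simpa using hn) (by omega) (by rw [hsum, ← h]; rfl)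
    have hcard : s.card = T.card := by rw [← hST]; rfl
    have hr : r.Nodup := by
      by_contra hr
      have := hT' hr
      omega
    have := sum_twoPow_injective (S := ⟨s, hs⟩) (T := ⟨r, hr⟩) (by simpa using hn)
      (by simpa [← hc] using hn) h
    exact congrArg Finset.val this
  by_cases hs : s.Nodup
  · exact Or.inl (key s r hc hn h hs)
  · by_cases hr : r.Nodup
    · exact Or.inl (key r s hc.symm (hc ▸ hn) h.symm hr).symm
    · exact Or.inr ⟨hs, hr⟩

/-! ### Comparing short sums of powers of two -/

lemma twoPow_injective {n : ℕ} [NeZero n] (hn : 1 < n) {a b : ZMod n}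
    (h : twoPow n a = twoPow n b) : a = b := by
  simpa using sum_twoPow_injective (S := {a}) (T := {b}) (by simpa) (by simpa) (by simpa)

lemma pair_eq_pair {α : Type*} {a b c d : α} (h : ({a, b} : Multiset α) = {c, d}) :
    a = c ∧ b = d ∨ a = d ∧ b = c := by
  have ha : a ∈ ({c, d} : Multiset α) := h ▸ by simp
  simp only [Multiset.insert_eq_cons, Multiset.mem_cons, Multiset.mem_singleton] at ha h
  rcases ha with rfl | rfl
  · exact Or.inl ⟨rfl, by simpa using h⟩
  · rw [← Multiset.cons_zero b, ← Multiset.cons_zero a, Multiset.cons_swap c a] at h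
    exact Or.inr ⟨rfl, by simpa using h⟩

lemma triple_eq_triple {α : Type*} {a b c d e f : α}
    (h : ({a, b, c} : Multiset α) = {d, e, f}) :
    a = d ∧ (b = e ∧ c = f ∨ b = f ∧ c = e) ∨ a = e ∧ (b = d ∧ c = f ∨ b = f ∧ c = d) ∨
      a = f ∧ (b = d ∧ c = e ∨ b = e ∧ c = d) := by
  have ha : a ∈ ({d, e, f} : Multiset α) := h ▸ by simp
  simp only [Multiset.insert_eq_cons, Multiset.mem_cons, Multiset.mem_singleton] at ha h
  rcases ha with rfl | rfl | rfl
  · exact Or.inl ⟨rfl, pair_eq_pair ((Multiset.cons_inj_right _).mp h)⟩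
  · rw [Multiset.cons_swap d a] at h
    exact Or.inr (Or.inl ⟨rfl, pair_eq_pair ((Multiset.cons_inj_right _).mp h)⟩)
  · rw [← Multiset.cons_zero a, Multiset.cons_swap e a, Multiset.cons_swap d a] at h
    exact Or.inr (Or.inr ⟨rfl, pair_eq_pair ((Multiset.cons_inj_right _).mp h)⟩)

lemma quadruple_eq_quadruple {α : Type*} {a b c d e f g k : α}
    (h : ({a, b, c, d} : Multiset α) = {e, f, g, k}) :
    a = e ∧ ({b, c, d} : Multiset α) = {f, g, k} ∨ a = f ∧ ({b, c, d} : Multiset α) = {e, g, k} ∨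
      a = g ∧ ({b, c, d} : Multiset α) = {e, f, k} ∨
      a = k ∧ ({b, c, d} : Multiset α) = {e, f, g} := by
  have ha : a ∈ ({e, f, g, k} : Multiset α) := h ▸ by simp
  simp only [Multiset.insert_eq_cons, Multiset.mem_cons, Multiset.mem_singleton] at ha h ⊢
  rcases ha with rfl | rfl | rfl | rfl
  · exact Or.inl ⟨rfl, (Multiset.cons_inj_right _).mp h⟩
  · rw [Multiset.cons_swap e a] at h
    exact Or.inr (Or.inl ⟨rfl, (Multiset.cons_inj_right _).mp h⟩)
  · rw [Multiset.cons_swap f a, Multiset.cons_swap e a] at h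
    exact Or.inr (Or.inr (Or.inl ⟨rfl, (Multiset.cons_inj_right _).mp h⟩))
  · rw [← Multiset.cons_zero a, Multiset.cons_swap g a, Multiset.cons_swap f a,
      Multiset.cons_swap e a] at h
    exact Or.inr (Or.inr (Or.inr ⟨rfl, (Multiset.cons_inj_right _).mp h⟩))

lemma twoPow_add_eq_two {n : ℕ} [NeZero n] (hn : 2 < n) {a b c d : ZMod n}
    (h : twoPow n a + twoPow n b = twoPow n c + twoPow n d) :
    (a = c ∧ b = d ∨ a = d ∧ b = c) ∨ a = b ∧ c = d := by
  rcases eq_or_not_nodup_of_sum_twoPow_eq (s := {a, b}) (r := {c, d}) (by simp) (by simpa)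
    (by simpa using h) with h | h
  · exact Or.inl (pair_eq_pair h)
  · simp at h
    grind

lemma twoPow_add_eq_three {n : ℕ} [NeZero n] (hn : 3 < n) {a b c d e f : ZMod n}
    (h : twoPow n a + twoPow n b + twoPow n c = twoPow n d + twoPow n e + twoPow n f) :
    (a = d ∧ (b = e ∧ c = f ∨ b = f ∧ c = e) ∨ a = e ∧ (b = d ∧ c = f ∨ b = f ∧ c = d) ∨
      a = f ∧ (b = d ∧ c = e ∨ b = e ∧ c = d)) ∨
    (a = b ∨ a = c ∨ b = c) ∧ (d = e ∨ d = f ∨ e = f) := by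
  rcases eq_or_not_nodup_of_sum_twoPow_eq (s := {a, b, c}) (r := {d, e, f}) (by simp) (by simpa)
    (by simpa [add_assoc] using h) with h | h
  · exact Or.inl (triple_eq_triple h)
  · right
    simp at h
    grind

lemma twoPow_add_eq_four {n : ℕ} [NeZero n] (hn : 4 < n) {a b c d e f g k : ZMod n}
    (h : twoPow n a + twoPow n b + twoPow n c + twoPow n d =
      twoPow n e + twoPow n f + twoPow n g + twoPow n k) :
    ({a, b, c, d} : Multiset (ZMod n)) = {e, f, g, k} ∨
    (a = b ∨ a = c ∨ a = d ∨ b = c ∨ b = d ∨ c = d) ∧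
      (e = f ∨ e = g ∨ e = k ∨ f = g ∨ f = k ∨ g = k) := by
  rcases eq_or_not_nodup_of_sum_twoPow_eq (s := {a, b, c, d}) (r := {e, f, g, k}) (by simp)
    (by simpa) (by simpa [add_assoc] using h) with h | h
  · exact Or.inl h
  · right
    simp at h
    grind

/-- Here `x`, `z` are the doubled exponents and `y`, `w` the leftover ones. One carry leaves two
terms per side; the last alternative is a second carry on both sides. -/
lemma twoPow_add_eq_three_cases {n : ℕ} [NeZero n] (hn : 3 < n) {a b c d e f : ZMod n}
    (h : twoPow n a + twoPow n b + twoPow n c = twoPow n d + twoPow n e + twoPow n f) :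
    (a = d ∧ (b = e ∧ c = f ∨ b = f ∧ c = e) ∨ a = e ∧ (b = d ∧ c = f ∨ b = f ∧ c = d) ∨
      a = f ∧ (b = d ∧ c = e ∨ b = e ∧ c = d)) ∨
    ∃ x y z w, (x = a ∧ a = b ∧ y = c ∨ x = a ∧ a = c ∧ y = b ∨ x = b ∧ b = c ∧ y = a) ∧
      (z = d ∧ d = e ∧ w = f ∨ z = d ∧ d = f ∧ w = e ∨ z = e ∧ e = f ∧ w = d) ∧
      (x = z ∧ y = w ∨ x + 1 = w ∧ y = z + 1 ∨ x = z ∧ y = x + 1 ∧ w = z + 1) := by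
  have key : ∀ x y z w : ZMod n, twoPow n x + twoPow n x + twoPow n y =
      twoPow n z + twoPow n z + twoPow n w →
      (x = z ∧ y = w ∨ x + 1 = w ∧ y = z + 1 ∨ x = z ∧ y = x + 1 ∧ w = z + 1) := by
    intro x y z w h
    rw [← twoPow_add_one, ← twoPow_add_one] at h
    rcases twoPow_add_eq_two (by omega) h with (⟨h1, h2⟩ | ⟨h1, h2⟩) | ⟨h1, h2⟩
    · exact Or.inl ⟨add_right_cancel h1, h2⟩
    · exact Or.inr (Or.inl ⟨h1, h2⟩)
    · rw [← h1, ← h2, ← twoPow_add_one, ← twoPow_add_one] at h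
      exact Or.inr (Or.inr ⟨add_right_cancel (add_right_cancel (twoPow_injective (by omega) h)),
        h1.symm, h2.symm⟩)
  rcases twoPow_add_eq_three hn h with h' | ⟨h1, h2⟩
  · exact Or.inl h'
  · right
    have hl : ∃ x y, (x = a ∧ a = b ∧ y = c ∨ x = a ∧ a = c ∧ y = b ∨ x = b ∧ b = c ∧ y = a) ∧
        twoPow n a + twoPow n b + twoPow n c = twoPow n x + twoPow n x + twoPow n y := by
      rcases h1 with rfl | rfl | rfl
      · exact ⟨a, c, by simp, rfl⟩
      · exact ⟨a, b, by simp, by ring⟩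
      · exact ⟨b, a, by simp, by ring⟩
    have hr : ∃ x y, (x = d ∧ d = e ∧ y = f ∨ x = d ∧ d = f ∧ y = e ∨ x = e ∧ e = f ∧ y = d) ∧
        twoPow n d + twoPow n e + twoPow n f = twoPow n x + twoPow n x + twoPow n y := by
      rcases h2 with rfl | rfl | rfl
      · exact ⟨d, f, by simp, rfl⟩
      · exact ⟨d, e, by simp, by ring⟩
      · exact ⟨e, d, by simp, by ring⟩
    obtain ⟨x, y, hxy, hl⟩ := hl
    obtain ⟨z, w, hzw, hr⟩ := hr
    exact ⟨x, y, z, w, hxy, hzw, key x y z w (by rw [← hl, ← hr, h])⟩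

set_option maxHeartbeats 4000000 in
/-- The equation obtained from `K_t = 2 ^ a * e(l, i)` by multiplying with `2 ^ i - 1`. -/
lemma kasami_mul_ne {n : ℕ} [NeZero n] (hn : 4 < n) {t i a b : ZMod n}
    (ht : t ≠ 0) (ht2 : 2 * t ≠ 0) (ht3 : 3 * t ≠ 0) (ht4 : 4 * t ≠ 0) (ht5 : 5 * t ≠ 0)
    (ht1 : t ≠ 1) (htm : t ≠ -1) (hi : i ≠ 0) :
    twoPow n (2 * t + i) + twoPow n i + twoPow n t + twoPow n a ≠
      twoPow n (t + i) + twoPow n (2 * t) + twoPow n 0 + twoPow n b := by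
  intro h
  rcases twoPow_add_eq_four hn h with h' | ⟨h1, h2⟩
  · rcases quadruple_eq_quadruple h' with ⟨h1, h'⟩ | ⟨h1, h'⟩ | ⟨h1, h'⟩ | ⟨h1, h'⟩ <;>
    have h'' := triple_eq_triple h' <;> clear h h' <;> grind
  -- `x` is a repeated exponent, `y` and `z` the other two; coincidences forcing `2 * t = 0`, `t =
  -- 0` or `i = 0` cannot occur.
  · have hl : ∃ x y z, twoPow n (2 * t + i) + twoPow n i + twoPow n t + twoPow n a =
          twoPow n (x + 1) + twoPow n y + twoPow n z ∧
        (x = t ∧ y = -t ∧ z = a ∧ i = -t ∨ x = t ∧ y = 3 * t ∧ z = a ∧ i = t ∨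
          x = 2 * t + i ∧ y = i ∧ z = t ∨ x = i ∧ y = 2 * t + i ∧ z = t ∨
          x = t ∧ y = 2 * t + i ∧ z = i) := by
      have h1' : i = -t ∨ i = t ∨ a = 2 * t + i ∨ a = i ∨ a = t := by grind
      rcases h1' with rfl | rfl | rfl | rfl | rfl
      · exact ⟨t, -t, a, by rw [twoPow_add_one]; ring_nf, by simp⟩
      · exact ⟨i, 3 * i, a, by rw [twoPow_add_one]; ring_nf, by simp⟩
      · exact ⟨2 * t + i, i, t, by rw [twoPow_add_one]; ring_nf, by simp⟩
      · exact ⟨a, 2 * t + a, t, by rw [twoPow_add_one]; ring_nf, by simp⟩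
      · exact ⟨a, 2 * a + i, i, by rw [twoPow_add_one]; ring_nf, by simp⟩
    have hr : ∃ x y z, twoPow n (t + i) + twoPow n (2 * t) + twoPow n 0 + twoPow n b =
          twoPow n (x + 1) + twoPow n y + twoPow n z ∧
        (x = 0 ∧ y = 2 * t ∧ z = b ∧ i = -t ∨ x = 2 * t ∧ y = 0 ∧ z = b ∧ i = t ∨
          x = t + i ∧ y = 2 * t ∧ z = 0 ∨ x = 2 * t ∧ y = t + i ∧ z = 0 ∨
          x = 0 ∧ y = t + i ∧ z = 2 * t) := by
      have h2' : i = -t ∨ i = t ∨ b = t + i ∨ b = 2 * t ∨ b = 0 := by grind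
      rcases h2' with rfl | rfl | rfl | rfl | rfl
      · exact ⟨0, 2 * t, b, by rw [twoPow_add_one]; ring_nf, by simp⟩
      · exact ⟨2 * i, 0, b, by rw [twoPow_add_one]; ring_nf, by simp⟩
      · exact ⟨t + i, 2 * t, 0, by rw [twoPow_add_one]; ring_nf, by simp⟩
      · exact ⟨2 * t, t + i, 0, by rw [twoPow_add_one]; ring_nf, by simp⟩
      · exact ⟨0, t + i, 2 * t, by rw [twoPow_add_one]; ring_nf, by simp⟩
    obtain ⟨x, y, z, hl, hl'⟩ := hl
    obtain ⟨w, u, v, hr, hr'⟩ := hr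
    rw [hl, hr] at h
    have h' := twoPow_add_eq_three_cases (by omega) h
    clear h hl hr h1 h2
    rcases hl' with ⟨rfl, rfl, rfl, hl'⟩ | ⟨rfl, rfl, rfl, hl'⟩ | ⟨rfl, rfl, rfl⟩ |
        ⟨rfl, rfl, rfl⟩ | ⟨rfl, rfl, rfl⟩ <;>
      rcases hr' with ⟨rfl, rfl, rfl, hr'⟩ | ⟨rfl, rfl, rfl, hr'⟩ | ⟨rfl, rfl, rfl⟩ |
        ⟨rfl, rfl, rfl⟩ | ⟨rfl, rfl, rfl⟩ <;>
      rcases h' with h | ⟨x, y, z, w, h⟩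
    all_goals grind

set_option maxHeartbeats 4000000 in
/-- The equation obtained from `K_t * 2 ^ a * e(l, i) = 1` by multiplying with `2 ^ i - 1`. -/
lemma kasami_mul_sub_ne {n : ℕ} [NeZero n] (hn : 4 < n) {t i a b : ZMod n}
    (ht : t ≠ 0) (ht2 : 2 * t ≠ 0) (ht3 : 3 * t ≠ 0) (ht4 : 4 * t ≠ 0) (ht5 : 5 * t ≠ 0)
    (ht1 : t ≠ 1) (htm : t ≠ -1) (hi : i ≠ 0) (hab : a ≠ b) :
    twoPow n (2 * t + b) + twoPow n (t + a) + twoPow n b + twoPow n 0 ≠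
      twoPow n (t + b) + twoPow n (2 * t + a) + twoPow n a + twoPow n i := by
  intro h
  rcases twoPow_add_eq_four hn h with h' | ⟨h1, h2⟩
  · rcases quadruple_eq_quadruple h' with ⟨h1, h'⟩ | ⟨h1, h'⟩ | ⟨h1, h'⟩ | ⟨h1, h'⟩ <;>
    have h'' := triple_eq_triple h' <;> clear h h' <;> grind
  · have hl : ∃ x y z, twoPow n (2 * t + b) + twoPow n (t + a) + twoPow n b + twoPow n 0 =
          twoPow n (x + 1) + twoPow n y + twoPow n z ∧
        (x = 2 * t + b ∧ y = b ∧ z = 0 ∧ a = t + b ∨ x = 0 ∧ y = t + a ∧ z = b ∧ b = -(2 * t) ∨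
          x = b ∧ y = 2 * t + b ∧ z = 0 ∧ b = t + a ∨ x = 0 ∧ y = 2 * t + b ∧ z = b ∧ a = -t ∨
          x = 0 ∧ y = 2 * t ∧ z = t + a ∧ b = 0) := by
      have h1' : a = t + b ∨ b = -(2 * t) ∨ b = t + a ∨ a = -t ∨ b = 0 := by grind
      rcases h1' with rfl | rfl | rfl | rfl | rfl
      · exact ⟨2 * t + b, b, 0, by rw [twoPow_add_one]; ring_nf, by simp⟩
      · exact ⟨0, t + a, -(2 * t), by rw [twoPow_add_one]; ring_nf, by simp⟩
      · exact ⟨t + a, 2 * t + (t + a), 0, by rw [twoPow_add_one]; ring_nf, by simp⟩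
      · exact ⟨0, 2 * t + b, b, by rw [twoPow_add_one]; ring_nf, by simp⟩
      · exact ⟨0, 2 * t, t + a, by rw [twoPow_add_one]; ring_nf, by simp⟩
    have hr : ∃ x y z, twoPow n (t + b) + twoPow n (2 * t + a) + twoPow n a + twoPow n i =
          twoPow n (x + 1) + twoPow n y + twoPow n z ∧
        (x = 2 * t + a ∧ y = a ∧ z = i ∧ b = t + a ∨ x = a ∧ y = 2 * t + a ∧ z = i ∧ a = t + b ∨
          x = i ∧ y = 2 * t + a ∧ z = a ∧ i = t + b ∨ x = i ∧ y = t + b ∧ z = a ∧ i = 2 * t + a ∨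
          x = a ∧ y = t + b ∧ z = 2 * t + a ∧ i = a) := by
      have h2' : b = t + a ∨ a = t + b ∨ i = t + b ∨ i = 2 * t + a ∨ i = a := by grind
      rcases h2' with rfl | rfl | rfl | rfl | rfl
      · exact ⟨2 * t + a, a, i, by rw [twoPow_add_one]; ring_nf, by simp⟩
      · exact ⟨t + b, 2 * t + (t + b), i, by rw [twoPow_add_one]; ring_nf, by simp⟩
      · exact ⟨t + b, 2 * t + a, a, by rw [twoPow_add_one]; ring_nf, by simp⟩
      · exact ⟨2 * t + a, t + b, a, by rw [twoPow_add_one]; ring_nf, by simp⟩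
      · exact ⟨i, t + b, 2 * t + i, by rw [twoPow_add_one]; ring_nf, by simp⟩
    obtain ⟨x, y, z, hl, hl'⟩ := hl
    obtain ⟨w, u, v, hr, hr'⟩ := hr
    rw [hl, hr] at h
    have h' := twoPow_add_eq_three_cases (by omega) h
    clear h hl hr h1 h2
    rcases hl' with ⟨rfl, rfl, rfl, hl'⟩ | ⟨rfl, rfl, rfl, hl'⟩ | ⟨rfl, rfl, rfl, hl'⟩ |
        ⟨rfl, rfl, rfl, hl'⟩ | ⟨rfl, rfl, rfl, hl'⟩ <;>
      rcases hr' with ⟨rfl, rfl, rfl, hr'⟩ | ⟨rfl, rfl, rfl, hr'⟩ | ⟨rfl, rfl, rfl, hr'⟩ |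
        ⟨rfl, rfl, rfl, hr'⟩ | ⟨rfl, rfl, rfl, hr'⟩ <;>
      rcases h' with h | ⟨x, y, z, w, h⟩
    all_goals grind

/-! ### Invertibility and the necessary condition -/

lemma kasami_cast (n t : ℕ) : (kasami t : ZMod (2 ^ n - 1)) =
    twoPow n (2 * t) - twoPow n t + twoPow n 0 := by
  have h : 2 ^ t ≤ 2 ^ (2 * t) := Nat.pow_le_pow_right two_pos (by omega)
  have h1 : twoPow n (2 * t) = 2 ^ (2 * t) := by exact_mod_cast twoPow_natCast n (2 * t)
  rw [kasami, h1, twoPow_natCast, twoPow_zero]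
  push_cast [h]
  ring

lemma expE_mul_sub_one (n l i : ℕ) : (expE l i : ZMod (2 ^ n - 1)) * (2 ^ i - 1) =
    2 ^ (i * l) - 1 := by
  rw [expE, pow_mul, ← geom_sum_mul ((2 : ZMod (2 ^ n - 1)) ^ i)]
  push_cast
  simp only [← pow_mul, mul_comm]

/-- Since `K_t * (2 ^ t + 1) = 2 ^ (3 * t) + 1`, the gcd divides `2 ^ gcd(6t, n) - 1`, which is 1 or
7. Modulo 7, `K_t` depends only on `t % 3` and is nonzero when `3 ∤ t`. -/
lemma coprime_kasami {n t : ℕ} (hn : Odd n) (hcop : Nat.gcd n t = 1) :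
    Nat.Coprime (kasami t) (2 ^ n - 1) := by
  have hle : 2 ^ t ≤ 2 ^ (2 * t) := Nat.pow_le_pow_right two_pos (by omega)
  have h1 : kasami t ∣ 2 ^ (6 * t) - 1 := by
    zify [Nat.one_le_two_pow (n := 6 * t)]
    refine ⟨(2 ^ t + 1) * (2 ^ (3 * t) - 1), ?_⟩
    rw [kasami]
    push_cast [hle]
    simp only [mul_comm _ t, pow_mul]
    ring
  have h2 : Nat.gcd (kasami t) (2 ^ n - 1) ∣ 2 ^ Nat.gcd (6 * t) n - 1 := by
    rw [← Nat.pow_sub_one_gcd_pow_sub_one]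
    exact Nat.dvd_gcd ((Nat.gcd_dvd_left _ _).trans h1) (Nat.gcd_dvd_right _ _)
  have h3 : Nat.gcd (6 * t) n = Nat.gcd 3 n := by
    rw [Nat.Coprime.gcd_mul_right_cancel 6 (Nat.Coprime.symm hcop)]
    exact Nat.Coprime.gcd_mul_left_cancel (k := 2) 3 (Nat.coprime_two_left.mpr hn)
  rw [h3] at h2
  rcases (Nat.dvd_prime Nat.prime_three).mp (Nat.gcd_dvd_left 3 n) with h | h
  · rw [h] at h2
    exact Nat.dvd_one.mp h2
  · rw [h] at h2
    have h3t : ¬ 3 ∣ t := fun ht => by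
      have := Nat.dvd_gcd (Nat.gcd_eq_left_iff_dvd.mp h) ht
      rw [hcop] at this
      omega
    refine ((Nat.dvd_prime (by norm_num : Nat.Prime 7)).mp h2).resolve_right fun h7 => ?_
    have hd : 7 ∣ kasami t := h7 ▸ Nat.gcd_dvd_left _ _
    have hz : (kasami t : ZMod 7) = 0 := (ZMod.natCast_eq_zero_iff _ _).mpr hd
    rw [kasami] at hz
    push_cast [hle] at hz
    rw [mul_comm 2 t, pow_mul, ← Nat.div_add_mod t 3, pow_add, pow_mul,
      show (2 : ZMod 7) ^ 3 = 1 from rfl, one_pow, one_mul] at hz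
    have : t % 3 = 1 ∨ t % 3 = 2 := by omega
    rcases this with h | h <;> rw [h] at hz <;> revert hz <;> decide

lemma isUnit_kasami {n t : ℕ} (hn : Odd n) (hcop : Nat.gcd n t = 1) :
    IsUnit (kasami t : ZMod (2 ^ n - 1)) :=
  (ZMod.isUnit_iff_coprime _ _).mpr (coprime_kasami hn hcop)

lemma eq_one_or_of_cyclotomicEquivalent {n t l i : ℕ} (hn : Odd n) (hn5 : n ≠ 5) (ht0 : 0 < t)
    (htn : t < n) (hcop : Nat.gcd n t = 1) (hi : ¬ n ∣ i)
    (h : CyclotomicEquivalent n (kasami t : ZMod (2 ^ n - 1))⁻¹ (expE l i : ZMod (2 ^ n - 1))) :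
    t = 1 ∨ t = n - 1 := by
  by_contra! hne
  obtain ⟨hne1, hne2⟩ := hne
  -- For `n = 3` only `t = 1` and `t = n - 1` exist, so `n ≥ 7`; this gives `k * t ≠ 0` for `0 < k <
  -- 6`.
  have hn7 : 6 < n := by
    obtain ⟨k, rfl⟩ := hn
    omega
  have : NeZero n := ⟨by omega⟩
  have hmul : ∀ k : ℕ, 0 < k → k < 6 → (k : ZMod n) * t ≠ 0 := by
    intro k hk hk' h0
    rw [← Nat.cast_mul, ZMod.natCast_eq_zero_iff] at h0
    have := Nat.le_of_dvd hk (Nat.Coprime.dvd_of_dvd_mul_right hcop h0)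
    omega
  have ht : (t : ZMod n) ≠ 0 := by simpa using hmul 1 (by omega) (by omega)
  have ht2 : 2 * (t : ZMod n) ≠ 0 := by exact_mod_cast hmul 2 (by omega) (by omega)
  have ht3 : 3 * (t : ZMod n) ≠ 0 := by exact_mod_cast hmul 3 (by omega) (by omega)
  have ht4 : 4 * (t : ZMod n) ≠ 0 := by exact_mod_cast hmul 4 (by omega) (by omega)
  have ht5 : 5 * (t : ZMod n) ≠ 0 := by exact_mod_cast hmul 5 (by omega) (by omega)
  have ht1 : (t : ZMod n) ≠ 1 := by
    intro h1
    rw [← Nat.cast_one, ZMod.natCast_eq_natCast_iff, Nat.ModEq, Nat.mod_eq_of_lt htn,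
      Nat.mod_eq_of_lt (by omega)] at h1
    exact hne1 h1
  have htm : (t : ZMod n) ≠ -1 := by
    intro h1
    have h2 : ((t + 1 : ℕ) : ZMod n) = 0 := by rw [Nat.cast_add, h1]; simp
    rw [ZMod.natCast_eq_zero_iff] at h2
    have := Nat.le_of_dvd (by omega) h2
    omega
  have hi0 : (i : ZMod n) ≠ 0 := fun h0 => hi ((ZMod.natCast_eq_zero_iff _ _).mp h0)
  have hK := ZMod.mul_inv_of_unit _ (isUnit_kasami hn hcop)
  have hKt := kasami_cast n t
  have hE := expE_mul_sub_one n l i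
  rw [← twoPow_natCast, ← twoPow_natCast, ← twoPow_zero] at hE
  rcases h with ⟨a, ha⟩ | ⟨y, hy, a, ha⟩
  · rw [← twoPow_natCast] at ha
    have hEq : (kasami t : ZMod (2 ^ n - 1)) *
        (twoPow n (a + (i * l : ℕ)) - twoPow n a) = twoPow n i - twoPow n 0 := by
      rw [ha] at hK
      rw [twoPow_add, ← mul_one (twoPow n i - _), ← hK]
      linear_combination (-(kasami t : ZMod (2 ^ n - 1)) * twoPow n a) * hE
        + (kasami t : ZMod (2 ^ n - 1)) * twoPow n a * twoPow_zero n
    refine kasami_mul_sub_ne (by omega) ht ht2 ht3 ht4 ht5 ht1 htm hi0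
      (a := (a : ZMod n)) (b := a + (i * l : ℕ)) ?_ ?_
    -- Equal exponents would give `2 ^ i = 1`, hence `n ∣ i`.
    · intro hab
      rw [← hab, sub_self, mul_zero] at hEq
      exact hi0 (twoPow_injective (by omega) (sub_eq_zero.mp hEq.symm))
    · rw [hKt] at hEq
      rw [twoPow_add (2 * (t : ZMod n)), twoPow_add (2 * (t : ZMod n)), twoPow_add (t : ZMod n),
        twoPow_add (t : ZMod n)]
      linear_combination hEq - (twoPow n (a + (i * l : ℕ)) - twoPow n a) * twoPow_zero n
  · have hyK : y = kasami t := by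
      calc y = kasami t * (kasami t : ZMod (2 ^ n - 1))⁻¹ * y := by rw [hK, one_mul]
        _ = kasami t := by rw [mul_assoc, hy, mul_one]
    rw [hyK, hKt, ← twoPow_natCast] at ha
    refine kasami_mul_ne (by omega) ht ht2 ht3 ht4 ht5 ht1 htm hi0 (a := (a : ZMod n))
      (b := a + (i * l : ℕ)) ?_
    rw [twoPow_add, twoPow_add, twoPow_add]
    linear_combination (twoPow n i - twoPow n 0) * ha + twoPow n a * hE
      + (twoPow n (2 * t) - twoPow n t - twoPow n i + twoPow n 0 - twoPow n a) * twoPow_zero n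

/-! ### The two exceptional exponents -/

lemma kasami_one_mul_expE {n : ℕ} (hn : Odd n) :
    (kasami 1 : ZMod (2 ^ n - 1)) * expE ((n + 1) / 2) 2 = 1 := by
  have h := expE_mul_sub_one n ((n + 1) / 2) 2
  have h2 : 2 * ((n + 1) / 2) = n + 1 := Nat.mul_div_cancel' hn.add_one.two_dvd
  rw [h2, pow_succ 2 n, two_pow_eq_one] at h
  have h3 : (kasami 1 : ZMod (2 ^ n - 1)) = 3 := by norm_num [kasami]
  rw [h3]
  linear_combination h

/-- As `2 ^ (n - 1)` is the inverse of 2, `K_{n-1} = 1/4 - 1/2 + 1`. -/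
lemma four_mul_kasami_sub_one {n : ℕ} (hn : 0 < n) :
    4 * (kasami (n - 1) : ZMod (2 ^ n - 1)) = kasami 1 := by
  have h : (2 : ZMod (2 ^ n - 1)) ^ (n - 1) * 2 = 1 := by
    rw [← pow_succ, Nat.sub_add_cancel hn, two_pow_eq_one]
  have hle : 2 ^ (n - 1) ≤ 2 ^ (2 * (n - 1)) := Nat.pow_le_pow_right two_pos (by omega)
  have h3 : (kasami 1 : ZMod (2 ^ n - 1)) = 3 := by norm_num [kasami]
  rw [h3, kasami]
  push_cast [hle]
  rw [mul_comm 2 (n - 1), pow_mul]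
  linear_combination (2 * (2 : ZMod (2 ^ n - 1)) ^ (n - 1) - 1) * h

lemma inv_kasami_one {n : ℕ} (hn : Odd n) :
    (kasami 1 : ZMod (2 ^ n - 1))⁻¹ = expE ((n + 1) / 2) 2 :=
  ZMod.inv_eq_of_mul_eq_one _ _ _ (kasami_one_mul_expE hn)

lemma inv_kasami_sub_one {n : ℕ} (hn : Odd n) :
    (kasami (n - 1) : ZMod (2 ^ n - 1))⁻¹ = 2 ^ 2 * expE ((n + 1) / 2) 2 := by
  refine ZMod.inv_eq_of_mul_eq_one _ _ _ ?_
  rw [← kasami_one_mul_expE hn, ← four_mul_kasami_sub_one hn.pos]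
  ring

theorem mainTheorem7 (n t : ℕ) (hn : Odd n) (hn5 : n ≠ 5) (ht0 : 0 < t) (htn : t < n)
    (hcop : Nat.gcd n t = 1) :
    -- the inverse of the Kasami exponent modulo `2^n - 1` exists
    IsUnit (kasami t : ZMod (2 ^ n - 1)) ∧
    -- the characterization
    ((∃ l i : ℕ, 0 < l ∧ 0 < i ∧ ¬ n ∣ i ∧
        CyclotomicEquivalent n (kasami t : ZMod (2 ^ n - 1))⁻¹ (expE l i : ZMod (2 ^ n - 1))) ↔
      t = 1 ∨ t = n - 1) ∧
    -- the relevant exponent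
    (t = 1 ∨ t = n - 1 →
      InCyclotomicCoset n (kasami t : ZMod (2 ^ n - 1))⁻¹
        (expE ((n + 1) / 2) 2 : ZMod (2 ^ n - 1))) ∧
    -- the inverses of `K_1` and `K_{n-1}` lie in the same cyclotomic class
    InCyclotomicCoset n (kasami 1 : ZMod (2 ^ n - 1))⁻¹
      (kasami (n - 1) : ZMod (2 ^ n - 1))⁻¹ := by
  have hn3 : 2 < n := by
    obtain ⟨k, rfl⟩ := hn
    omega
  have hcoset : t = 1 ∨ t = n - 1 → InCyclotomicCoset n (kasami t : ZMod (2 ^ n - 1))⁻¹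
      (expE ((n + 1) / 2) 2 : ZMod (2 ^ n - 1)) := by
    rintro (rfl | rfl)
    · exact ⟨0, by rw [inv_kasami_one hn, pow_zero, one_mul]⟩
    · exact ⟨2, inv_kasami_sub_one hn⟩
  refine ⟨isUnit_kasami hn hcop, ⟨?_, fun h => ?_⟩, hcoset, ?_⟩
  · rintro ⟨l, i, -, -, hi, h⟩
    exact eq_one_or_of_cyclotomicEquivalent hn hn5 ht0 htn hcop hi h
  · exact ⟨(n + 1) / 2, 2, by omega, by omega, Nat.not_dvd_of_pos_of_lt two_pos hn3,
      Or.inl (hcoset h)⟩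
  -- `2 ^ (n - 2)` cancels the factor `2 ^ 2`.
  · refine ⟨n - 2, ?_⟩
    rw [inv_kasami_one hn, inv_kasami_sub_one hn, ← mul_assoc, ← pow_add,
      Nat.sub_add_cancel hn3.le, two_pow_eq_one, one_mul]
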